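/- **Theorem 3.1.** Let $s,d\ge 1$, let $\mathcal C$ be the set of all configurations $u:\mathbb Z^s\to\mathbb R^d$, let $\|\cdot\|$ be the Euclidean norm, $\overline B_r(x)$ the closed ball in $\mathbb R^d$, and $d(u,u')=\sup_{i}\|u_i-u'_i\|\in[0,\infty]$. Let $\Delta:\mathcal C\to\mathcal C$ be an invariant operator, that is, for all $u\in\mathcal C$, $k\in\mathbb Z^s$, $c\in\mathbb R^d$: $\Delta(u_{\cdot+k})=\Delta(u)_{\cdot+k}$ and $\Delta(u+c)=\Delta(u)$. For $\rho\in\operatorname{Hom}(\mathbb Z^s,\mathbb R^d)$ put $\Delta|_{\operatorname{Hom}}(\rho):=\Delta(\rho)_0$. Let $\psi:\mathbb R^d\to\mathbb R^d$, and let $\Psi(u)_i=\psi(u_i)$ be the associated pointwise operator. Suppose: (i) for every $\rho\in\operatorname{Hom}(\mathbb Z^s,\mathbb R^d)$ and every $R'>0$, $\Delta$ is Lipschitz with constant $K(\rho,R')>0$ on the closed ball $\{u: d(u,\rho)\le R'\}$, i.e. $d(\Delta u,\Delta u')\le K(\rho,R')\,d(u,u')$ for all $u,u'$ in it; (ii)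 $\psi$ satisfies the Aubry criterion with parameters $O\subset\mathbb R^d$ and $R,r,m>0$: $\psi$ is continuous; every closed ball of radius $R$ contains a point of $O$; $\psi(z)=0$ for all $z\in O$; and $\|\psi(x)-\psi(y)\|\ge m\|x-y\|$ for all $z\in O$ and $x,y\in\overline B_r(z)$. Let $\rho\in\operatorname{Hom}(\mathbb Z^s,\mathbb R^d)$ and put $$\lambda_*:=\frac{K(\rho,r+R)\,(r+R)+\|\Delta|_{\operatorname{Hom}}(\rho)\|}{rm}.$$ Then for every real $\lambda\ge\lambda_*$ there is a configuration $u$ with $$(\Delta+\lambda\Psi)u=0,\qquad \sup_{i\in\mathbb Z^s}\inf_{z\in O}\|u_i-z\|\le r,\qquad d(u,\rho)\le r+R .$$ Moreover $u$ is unique in the following sense. Let $u'$ be a configuration with $(\Delta+\lambda\Psi)u'=0$ such that for every $i\in\mathbb Z^s$ there is $x\in O$ with $u_i,u'_i\in\overline B_r(x)$. If $\lambda>\lambda_*$, or if $d(u',\rho)\le r+R$, then $u'=u$. -/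

import Mathlib

open scoped ENNReal

noncomputable section

namespace AntiIntegrable

/-- `ℝ^d` with its standard Euclidean norm. -/
abbrev Space (d : ℕ) : Type := EuclideanSpace ℝ (Fin d)

/-- The lattice `ℤ^s`. -/
abbrev Lattice (s : ℕ) : Type := Fin s → ℤ

/-- Configurations: all functions from `ℤ^s` to `ℝ^d`. -/
abbrev Config (s d : ℕ) : Type := Lattice s → Space d

/-- The group homomorphisms from `ℤ^s` to `ℝ^d`. -/
abbrev LatticeHom (s d : ℕ) : Type := Lattice s →+ Space d

variable {s d : ℕ}

/-- The extended metric `d(u,v) = sup_i ‖u_i - v_i‖`, with values in `[0,∞]`. -/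
def supDist (u v : Config s d) : ℝ≥0∞ := ⨆ i, edist (u i) (v i)

/-- The closed ball `{v | d(v,u) ≤ R}` of configurations. -/
def closedBall (u : Config s d) (R : ℝ) : Set (Config s d) :=
  {v | supDist v u ≤ ENNReal.ofReal R}

/-- The shift operator `S^k(u)_i = u_{i+k}`. -/
def shift (k : Lattice s) (u : Config s d) : Config s d := fun i => u (i + k)

/-- The translation operator `T^c(u)_i = u_i + c`. -/
def translate (c : Space d) (u : Config s d) : Config s d := fun i => u i + c

/-- An operator is invariant if it commutes with all shifts (horizontal invariance) and is
unchanged under composition with all translations (vertical invariance). -/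
structure IsInvariant (Δ : Config s d → Config s d) : Prop where
  horizontal : ∀ (k : Lattice s) (u : Config s d), Δ (shift k u) = shift k (Δ u)
  vertical : ∀ (c : Space d) (u : Config s d), Δ (translate c u) = Δ u

/-- The value `Δ|_Hom(ρ) = Δ(ρ)_0` of an (invariant) operator on a homomorphism. -/
def onHom (Δ : Config s d → Config s d) (ρ : LatticeHom s d) : Space d := Δ (⇑ρ) 0

/-- `Δ` is Lipschitz continuous on the set `A` of configurations, with constant `K > 0`. -/
def IsLipschitzOn (Δ : Config s d → Config s d) (K : ℝ) (A : Set (Config s d)) : Prop :=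
  0 < K ∧ ∀ u ∈ A, ∀ v ∈ A, supDist (Δ u) (Δ v) ≤ ENNReal.ofReal K * supDist u v

/-- `Ψ` is the pointwise operator with pointwise function `ψ`. -/
def IsPointwise (Ψ : Config s d → Config s d) (ψ : Space d → Space d) : Prop :=
  ∀ (u : Config s d) (i : Lattice s), Ψ u i = ψ (u i)

/-- The continuous function `ψ` satisfies the Aubry criterion with parameters `O, R, r, m`. -/
structure AubryCriterion (ψ : Space d → Space d) (O : Set (Space d)) (R r m : ℝ) : Prop where
  continuous : Continuous ψ
  R_pos : 0 < R
  r_pos : 0 < r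
  m_pos : 0 < m
  dense : ∀ x : Space d, ∃ z ∈ O, z ∈ Metric.closedBall x R
  zero : ∀ z ∈ O, ψ z = 0
  expanding : ∀ z ∈ O, ∀ x ∈ Metric.closedBall z r, ∀ y ∈ Metric.closedBall z r,
    m * ‖x - y‖ ≤ ‖ψ x - ψ y‖

/-- The threshold `(K (r + R) + ‖Δ|_Hom(ρ)‖) / (r m)` for the coupling parameter. -/
def threshold (Δ : Config s d → Config s d) (ρ : LatticeHom s d) (K R r m : ℝ) : ℝ :=
  (K * (r + R) + ‖onHom Δ ρ‖) / (r * m)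

/-- For every site `i` some closed ball of radius `r` around a point of `O` contains both `u_i`
and `v_i`. -/
def InCommonBalls (O : Set (Space d)) (r : ℝ) (u v : Config s d) : Prop :=
  ∀ i, ∃ x ∈ O, u i ∈ Metric.closedBall x r ∧ v i ∈ Metric.closedBall x r

end AntiIntegrable

end

open MeasureTheory Set Metric Module
open scoped NNReal Topology

/-! ### A volume identity for Lipschitz perturbations of the identity -/

section LipschitzDegree

/-! The equation is solved by inverting λψ site by site. Choose a zero v_i ∈ O of ψ within R of ρ_i.
On the ball of radius r about v_i the map ψ is continuous and expanding, so its image covers the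
ball of radius mr about 0 (`closedBall_subset_image_of_expanding`). Invariance makes Δρ constant, so
on the product of these balls ‖Δu‖ ≤ K(r+R) + ‖Δ|_Hom(ρ)‖ ≤ λmr. Hence λψ(u') = -Δu has a solution
u' in the product, and u ↦ u' contracts the supremum distance by K/(λm) < 1; its fixed point is the
required configuration.

The same contraction estimate makes two solutions in common balls equal, provided both lie in the
Lipschitz region. For λ > λ_* this proviso is automatic: then ‖ψ(u_i)‖ < mr, and
`eq_of_expanding_of_mem_closedBall` forces the common ball to be centred at v_i.

The topological input is proved by analysis. A Milnor–Rogers volume argument excludes Lipschitz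
retractions of a ball onto its sphere; smoothing then shows that continuous maps equal to the
identity off a ball are surjective; this yields invariance of domain for expanding maps. -/

theorem LipschitzWith.hausdorffMeasure_image_eq_zero {E : Type*} [NormedAddCommGroup E] [NormedSpace ℝ E]
    [MeasurableSpace E] [BorelSpace E] {g : E → E} {C : ℝ≥0}
    (hg : LipschitzWith C g) {s : Set E} (hs : (μH[finrank ℝ E] : Measure E) s = 0) :
    (μH[finrank ℝ E] : Measure E) (g '' s) = 0 := by
  have := hg.hausdorffMeasure_image_le (d := finrank ℝ E) (by positivity) s
  rw [hs, mul_zero] at this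
  exact le_antisymm this bot_le

variable {E : Type*} [NormedAddCommGroup E] [InnerProductSpace ℝ E] [FiniteDimensional ℝ E]

/-- Along the segment 1 + tA, t ∈ [0,1], a kernel vector would satisfy ‖x‖ ≤ ‖A‖‖x‖, so the
determinant never vanishes and keeps the sign it has at t = 0. -/
theorem det_one_add_pos_of_norm_lt_one {A : E →L[ℝ] E} (hA : ‖A‖ < 1) :
    0 < (1 + A).det := by
  have hne : ∀ t ∈ Icc (0 : ℝ) 1, (1 + t • A).det ≠ 0 := by
    intro t ht h0
    have hinj : LinearMap.ker ((1 + t • A : E →L[ℝ] E) : E →ₗ[ℝ] E) = ⊥ := by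
      rw [LinearMap.ker_eq_bot']
      intro x hx
      have hx' : x = -(t • A x) := by
        have : x + t • A x = 0 := by simpa using hx
        exact eq_neg_of_add_eq_zero_left this
      by_contra hx0
      have hpos : 0 < ‖x‖ := norm_pos_iff.2 hx0
      have h1 : ‖x‖ ≤ ‖A‖ * ‖x‖ := by
        calc ‖x‖ = ‖t • A x‖ := by rw [hx', norm_neg, ← hx']
          _ = t * ‖A x‖ := by rw [norm_smul, Real.norm_of_nonneg ht.1]
          _ ≤ 1 * ‖A x‖ := by gcongr; exact ht.2
          _ ≤ ‖A‖ * ‖x‖ := by rw [one_mul]; exact A.le_opNorm x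
      nlinarith
    exact (LinearMap.bot_lt_ker_of_det_eq_zero h0).ne' hinj
  have hcont : Continuous fun t : ℝ => (1 + t • A).det :=
    ContinuousLinearMap.continuous_det.comp (by fun_prop)
  by_contra hneg
  have h1 : (fun t : ℝ => (1 + t • A).det) 1 ≤ 0 := by simpa using not_lt.1 hneg
  have h0 : (0 : ℝ) ≤ (fun t : ℝ => (1 + t • A).det) 0 := by
    simp [ContinuousLinearMap.det]
  obtain ⟨t, ht, h⟩ := intermediate_value_Icc' zero_le_one hcont.continuousOn ⟨h1, h0⟩
  exact hne t ht h

/-- Lipschitz perturbations of the identity of small constant, trivial outside a ball,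
map that ball bijectively to itself. -/
theorem bijOn_closedBall_of_lipschitz {g : E → E} {C : ℝ≥0} (hg : LipschitzWith C g)
    (hC : C < 1) {c : E} {ρ : ℝ} (h0 : ∀ x ∉ closedBall c ρ, g x = 0) :
    BijOn (fun x => x + g x) (closedBall c ρ) (closedBall c ρ) := by
  have hinj : Function.Injective fun x => x + g x := by
    intro x y hxy
    by_contra hne
    have hpos : 0 < dist x y := dist_pos.2 hne
    have h1 : dist x y ≤ C * dist x y := by
      calc dist x y = dist (g y) (g x) := by
            rw [dist_eq_norm, dist_eq_norm]
            congr 1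
            have : x + g x = y + g y := hxy
            rw [sub_eq_sub_iff_add_eq_add, this, add_comm]
        _ ≤ C * dist x y := by rw [dist_comm x y]; exact hg.dist_le_mul y x
    have : (C : ℝ) < 1 := by exact_mod_cast hC
    nlinarith
  refine ⟨?_, hinj.injOn, ?_⟩
  -- A point leaving the ball would have a fixed image, and injectivity would make the point equal
  -- to that image.
  · intro x hx
    by_contra hfx
    have h1 : (fun x => x + g x) (x + g x) = x + g x := by
      simp only; rw [h0 _ hfx, add_zero]
    have h2 : x + g x = x := hinj h1
    simp only [h2] at hfx
    exact hfx hx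
  · intro y hy
    have hcon : ContractingWith C fun x => y - g x := by
      refine ⟨hC, ?_⟩
      simpa using (LipschitzWith.const y).sub hg
    have hfix := hcon.fixedPoint_isFixedPt
    set x := hcon.fixedPoint with hx
    have hxy : x + g x = y := by
      have : y - g x = x := hfix
      rw [sub_eq_iff_eq_add] at this; exact this.symm
    refine ⟨x, ?_, hxy⟩
    by_contra hxB
    rw [h0 _ hxB, add_zero] at hxy
    exact hxB (hxy ▸ hy)

open Polynomial in
-- Polynomial dependence on t lets identities known for small t be carried to t = 1.
theorem exists_polynomial_eval_eq_det_one_add_smul (A : E →L[ℝ] E) :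
    ∃ p : ℝ[X], p.natDegree ≤ finrank ℝ E ∧ ∀ t, p.eval t = (1 + t • A).det := by
  classical
  let b := finBasis ℝ E
  let M := LinearMap.toMatrix b b (A : E →ₗ[ℝ] E)
  refine ⟨Matrix.det ((X : ℝ[X]) • M.map C + (1 : Matrix _ _ ℝ).map C), ?_, fun t => ?_⟩
  · simpa using natDegree_det_X_add_C_le M 1
  · rw [← coe_evalRingHom, RingHom.map_det, ContinuousLinearMap.det,
      ← LinearMap.det_toMatrix b]
    congr 1
    ext i j
    by_cases hij : i = j <;> simp [M, LinearMap.toMatrix_one, hij] <;> ring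

variable [MeasurableSpace E] [BorelSpace E]

theorem measurable_det_one_add_smul_fderiv (g : E → E) (t : ℝ) :
    Measurable fun x => (1 + t • fderiv ℝ g x).det := by
  borelize (E →L[ℝ] E)
  exact ContinuousLinearMap.continuous_det.measurable.comp
    (((measurable_fderiv ℝ g).const_smul t).const_add 1)

theorem integrableOn_det_one_add_smul_fderiv {g : E → E} {C : ℝ≥0} (hg : LipschitzWith C g)
    (t : ℝ) (c : E) (ρ : ℝ) :
    IntegrableOn (fun x => (1 + t • fderiv ℝ g x).det) (closedBall c ρ)
      (μH[finrank ℝ E] : Measure E) := by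
  have hK : IsCompact (closedBall (0 : E →L[ℝ] E) C) := isCompact_closedBall _ _
  have hcont : Continuous fun A : E →L[ℝ] E => (1 + t • A).det :=
    ContinuousLinearMap.continuous_det.comp (by fun_prop)
  obtain ⟨M, hM⟩ := hK.exists_bound_of_continuousOn hcont.continuousOn
  refine Measure.integrableOn_of_bounded (M := M) ?_
    (measurable_det_one_add_smul_fderiv g t).aestronglyMeasurable ?_
  · exact (isCompact_closedBall c ρ).measure_lt_top.ne
  · refine Filter.Eventually.of_forall fun x => hM _ ?_
    rw [mem_closedBall_zero_iff]
    exact norm_fderiv_le_of_lipschitz ℝ hg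

/-- For tC < 1 the map x + t g(x) permutes the ball and has positive Jacobian wherever g is
differentiable, so this is the change of variables formula. By Rademacher the exceptional set is
null, and so is its image under a Lipschitz map. -/
theorem setIntegral_det_one_add_smul_fderiv_of_lt_one {g : E → E} {C : ℝ≥0}
    (hg : LipschitzWith C g) {c : E} {ρ : ℝ} (h0 : ∀ x ∉ closedBall c ρ, g x = 0)
    {t : ℝ} (ht : 0 ≤ t) (htC : t * C < 1) :
    ∫ x in closedBall c ρ, (1 + t • fderiv ℝ g x).det ∂(μH[finrank ℝ E] : Measure E) =
      (μH[finrank ℝ E] : Measure E).real (closedBall c ρ) := by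
  set μ : Measure E := μH[finrank ℝ E] with hμ
  set B := closedBall c ρ with hB
  set D := {x | DifferentiableAt ℝ g x} with hD
  lift t to ℝ≥0 using ht
  have hgt : LipschitzWith (t * C) fun x => (t : ℝ) • g x := by
    have := (lipschitzWith_smul (t : ℝ) (β := E)).comp hg
    simpa [Function.comp_def] using this
  have hbij := bijOn_closedBall_of_lipschitz hgt (by exact_mod_cast htC) (c := c) (ρ := ρ)
    (fun x hx => by simp [h0 x hx])
  set f : E → E := fun x => x + (t : ℝ) • g x with hf
  have hDm : MeasurableSet D := measurableSet_of_differentiableAt ℝ g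
  have hDnull : μ Dᶜ = 0 := by
    have := hg.ae_differentiableAt (μ := μ)
    exact this
  have hs : MeasurableSet (B ∩ D) := measurableSet_closedBall.inter hDm
  have hderiv : ∀ x ∈ B ∩ D,
      HasFDerivWithinAt f (1 + (t : ℝ) • fderiv ℝ g x) (B ∩ D) x := by
    intro x hx
    exact ((hasFDerivAt_id x).add (hx.2.hasFDerivAt.const_smul (t : ℝ))).hasFDerivWithinAt
  have hchange := lintegral_abs_det_fderiv_eq_addHaar_image μ hs hderiv
    (hbij.injOn.mono inter_subset_left)
  have hfl : LipschitzWith (1 + t * C) f := LipschitzWith.id.add hgt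
  have himage : μ (f '' (B ∩ D)) = μ B := by
    refine le_antisymm (measure_mono ((image_mono inter_subset_left).trans
      hbij.image_eq.subset)) ?_
    calc μ B ≤ μ (f '' (B ∩ D) ∪ f '' Dᶜ) := by
          refine measure_mono ?_
          rw [← image_union]
          refine hbij.image_eq.symm.subset.trans (image_mono fun x hx => ?_)
          by_cases hxD : x ∈ D
          · exact Or.inl ⟨hx, hxD⟩
          · exact Or.inr hxD
      _ ≤ μ (f '' (B ∩ D)) + μ (f '' Dᶜ) := measure_union_le _ _
      _ = μ (f '' (B ∩ D)) := by
          rw [hfl.hausdorffMeasure_image_eq_zero hDnull, add_zero]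
  have hpos : ∀ x, 0 < (1 + (t : ℝ) • fderiv ℝ g x).det := by
    intro x
    apply det_one_add_pos_of_norm_lt_one
    calc ‖(t : ℝ) • fderiv ℝ g x‖ = t * ‖fderiv ℝ g x‖ := by
          rw [norm_smul, Real.norm_of_nonneg t.coe_nonneg]
      _ ≤ t * C := by
          gcongr; exact norm_fderiv_le_of_lipschitz ℝ hg
      _ < 1 := htC
  have hae : (B ∩ D : Set E) =ᵐ[μ] B := by
    refine inter_ae_eq_left_of_ae_eq_univ ?_
    rw [ae_eq_univ]; exact hDnull
  rw [integral_eq_lintegral_of_nonneg_ae (Filter.Eventually.of_forall fun x => (hpos x).le)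
    (measurable_det_one_add_smul_fderiv g t).aestronglyMeasurable, Measure.real, ← himage,
    ← hchange, Measure.restrict_congr_set hae]
  simp_rw [abs_of_pos (hpos _)]

/-- The integral of det(1 + t Dg) is a polynomial in t of degree at most n that is constant for
small t, hence constant up to t = 1. Interpolation at n + 1 small nodes expresses this pointwise,
under the integral sign. -/
theorem setIntegral_det_one_add_fderiv {g : E → E} {C : ℝ≥0}
    (hg : LipschitzWith C g) {c : E} {ρ : ℝ} (h0 : ∀ x ∉ closedBall c ρ, g x = 0) :
    ∫ x in closedBall c ρ, (1 + fderiv ℝ g x).det ∂(μH[finrank ℝ E] : Measure E) =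
      (μH[finrank ℝ E] : Measure E).real (closedBall c ρ) := by
  set n := finrank ℝ E
  -- Distinct nodes, all satisfying v j * C < 1.
  let v : ℕ → ℝ := fun j => 1 / ((j + 1) * (C + 1))
  let s := Finset.range (n + 1)
  have hC : (0 : ℝ) < C + 1 := by positivity
  have hv : InjOn v s := by
    intro i _ j _ h
    have h' : ((i : ℝ) + 1) * (C + 1) = (j + 1) * (C + 1) := by
      simpa [v] using h
    have := mul_right_cancel₀ hC.ne' h'
    exact_mod_cast add_right_cancel this
  have hinterp : ∀ p : Polynomial ℝ, p.natDegree ≤ n →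
      p.eval 1 = ∑ j ∈ s, p.eval (v j) * (Lagrange.basis s v j).eval 1 := by
    intro p hp
    have hdeg : p.degree < s.card := by
      refine p.degree_le_natDegree.trans_lt ?_
      simp only [s, Finset.card_range]
      exact_mod_cast Nat.lt_succ_of_le hp
    conv_lhs => rw [Lagrange.eq_interpolate hv hdeg]
    simp [Lagrange.interpolate_apply, Polynomial.eval_finsetSum]
  have hone : ∑ j ∈ s, (Lagrange.basis s v j).eval 1 = 1 := by
    have := hinterp 1 (by simp)
    simpa using this.symm
  have hdet : ∀ x, (1 + fderiv ℝ g x).det =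
      ∑ j ∈ s, (1 + v j • fderiv ℝ g x).det * (Lagrange.basis s v j).eval 1 := by
    intro x
    obtain ⟨p, hp, hpe⟩ := exists_polynomial_eval_eq_det_one_add_smul (fderiv ℝ g x)
    have := hinterp p hp
    simpa [hpe] using this
  simp_rw [hdet]
  rw [integral_finsetSum _ fun j _ =>
    (integrableOn_det_one_add_smul_fderiv hg (v j) c ρ).mul_const _]
  have hterm : ∀ j ∈ s, ∫ x in closedBall c ρ, (1 + v j • fderiv ℝ g x).det *
      (Lagrange.basis s v j).eval 1 ∂(μH[n] : Measure E) =
      (μH[n] : Measure E).real (closedBall c ρ) * (Lagrange.basis s v j).eval 1 := by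
    intro j _
    rw [integral_mul_const, setIntegral_det_one_add_smul_fderiv_of_lt_one hg h0]
    · simp only [v]; positivity
    · simp only [v]
      rw [div_mul_eq_mul_div, one_mul, div_lt_one (by positivity)]
      have : (0 : ℝ) ≤ j := by positivity
      have : (0 : ℝ) ≤ C := C.2
      nlinarith
  rw [Finset.sum_congr rfl hterm, ← Finset.mul_sum, hone, mul_one]

end LipschitzDegree

/-! ### No Lipschitz retraction onto the sphere -/

section Surjectivity

variable {E : Type*} [NormedAddCommGroup E] [InnerProductSpace ℝ E]

/-- Differentiating the constant ‖F - c‖² shows that the range of A is orthogonal to F x - c, which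
is nonzero; so A is not surjective. -/
theorem det_eq_zero_of_norm_sub_eventually_const [FiniteDimensional ℝ E] {F : E → E}
    {A : E →L[ℝ] E} {x c : E}
    {ρ : ℝ} (hρ : 0 < ρ) (hF : HasFDerivAt F A x) (hc : ∀ᶠ y in 𝓝 x, ‖F y - c‖ = ρ) :
    A.det = 0 := by
  by_contra hdet
  have h1 : HasFDerivAt (fun y => ‖F y - c‖ ^ 2) (2 • (innerSL ℝ (F x - c)).comp A) x :=
    (hF.sub_const c).norm_sq
  have h2 : HasFDerivAt (fun y => ‖F y - c‖ ^ 2) (0 : E →L[ℝ] ℝ) x := by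
    refine (hasFDerivAt_const (ρ ^ 2) x).congr_of_eventuallyEq ?_
    filter_upwards [hc] with y hy
    rw [hy]
  have h3 := h1.unique h2
  have hsurj : Function.Surjective (A : E →ₗ[ℝ] E) := by
    have hu : IsUnit (LinearMap.det (A : E →ₗ[ℝ] E)) := isUnit_iff_ne_zero.2 hdet
    exact (LinearMap.equivOfDetNeZero _ hu.ne_zero).surjective
  obtain ⟨v, hv⟩ := hsurj (F x - c)
  have h4 := congrArg (fun L : E →L[ℝ] ℝ => L v) h3
  have hv' : A v = F x - c := hv
  have hn := hc.self_of_nhds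
  have h5 : (2 : ℕ) • inner ℝ (F x - c) (A v) = (0 : ℝ) := h4
  rw [hv', real_inner_self_eq_norm_sq, hn] at h5
  simp [hρ.ne'] at h5

/-- There is no Lipschitz retraction of a ball onto its boundary sphere. -/
theorem not_norm_sub_eq_of_lipschitz [FiniteDimensional ℝ E] {F : E → E} {C : ℝ≥0}
    (hF : LipschitzWith C F)
    {c : E} {ρ : ℝ} (hρ : 0 < ρ) (hid : ∀ x ∉ closedBall c ρ, F x = x) :
    ¬ ∀ x ∈ closedBall c ρ, ‖F x - c‖ = ρ := by
  intro hsph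
  borelize E
  set μ : Measure E := μH[finrank ℝ E] with hμ
  have hg : LipschitzWith (C + 1) fun x => F x - x := hF.sub LipschitzWith.id
  have hint := setIntegral_det_one_add_fderiv hg (c := c) (ρ := ρ)
    fun x hx => by simp [hid x hx]
  -- The Jacobian of F vanishes almost everywhere in the ball, whereas its integral is the volume of
  -- the ball. The null sphere is discarded because the norm constraint holds on a neighbourhood
  -- only at interior points.
  have hzero : ∀ᵐ x ∂μ, x ∈ closedBall c ρ →
      (1 + fderiv ℝ (fun x => F x - x) x).det = 0 := by
    have hs : ∀ᵐ x ∂μ, x ∉ sphere c ρ := by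
      exact compl_mem_ae_iff.2 (Measure.addHaar_sphere_of_ne_zero μ c hρ.ne')
    filter_upwards [hs, hF.ae_differentiableAt (μ := μ)] with x hx hdx hxB
    have hxb : x ∈ ball c ρ := by
      rw [← closedBall_sdiff_sphere]; exact ⟨hxB, hx⟩
    have hd : fderiv ℝ (fun x => F x - x) x = fderiv ℝ F x - 1 :=
      (hdx.hasFDerivAt.sub (hasFDerivAt_id x)).fderiv
    rw [hd, add_sub_cancel]
    refine det_eq_zero_of_norm_sub_eventually_const hρ hdx.hasFDerivAt (c := c) ?_
    filter_upwards [isOpen_ball.mem_nhds hxb] with y hy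
    exact hsph y (ball_subset_closedBall hy)
  rw [setIntegral_congr_ae measurableSet_closedBall hzero, integral_zero] at hint
  have hpos : 0 < μ.real (closedBall c ρ) :=
    ENNReal.toReal_pos (measure_closedBall_pos μ c hρ).ne'
      (isCompact_closedBall c ρ).measure_lt_top.ne
  exact hpos.ne hint

/-- The map moving the points of the ball of radius `ρ` around `w` radially to its boundary. -/
noncomputable def radialPush (w : E) (ρ : ℝ) (y : E) : E :=
  w + max 1 (ρ / ‖y - w‖) • (y - w)

theorem radialPush_of_le {w y : E} {ρ : ℝ} (h : ρ ≤ ‖y - w‖) : radialPush w ρ y = y := by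
  rw [radialPush, max_eq_left (div_le_one_of_le₀ h (norm_nonneg _)), one_smul,
    add_sub_cancel]

theorem norm_radialPush_sub {w y : E} {ρ : ℝ} (hy : y ≠ w) (h : ‖y - w‖ ≤ ρ) :
    ‖radialPush w ρ y - w‖ = ρ := by
  have hpos : 0 < ‖y - w‖ := norm_pos_iff.2 (sub_ne_zero.2 hy)
  have h1 : 1 ≤ ρ / ‖y - w‖ := (one_le_div hpos).2 h
  rw [radialPush, max_eq_right h1, add_sub_cancel_left, norm_smul,
    Real.norm_of_nonneg (zero_le_one.trans h1), div_mul_cancel₀ _ hpos.ne']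

theorem continuousAt_radialPush {w y : E} {ρ : ℝ} (hy : y ≠ w) :
    ContinuousAt (radialPush w ρ) y := by
  have hpos : ‖y - w‖ ≠ 0 := (norm_pos_iff.2 (sub_ne_zero.2 hy)).ne'
  unfold radialPush
  have hn : ContinuousAt (fun y : E => ‖y - w‖) y := by fun_prop
  have hd : ContinuousAt (fun y : E => ρ / ‖y - w‖) y := continuousAt_const.div hn hpos
  exact continuousAt_const.add ((continuousAt_const.max hd).smul
    (continuousAt_id.sub continuousAt_const))

/-- The scaling factor blows up only at w, so staying at distance δ from w bounds both the factor
and its variation. -/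
theorem lipschitzOnWith_radialPush (w : E) {ρ δ : ℝ≥0} (hδ : 0 < δ) :
    LipschitzOnWith (1 + ρ / δ + ρ / δ) (radialPush w ρ) {y | (δ : ℝ) ≤ ‖y - w‖} := by
  refine LipschitzOnWith.of_dist_le_mul fun x hx y hy => ?_
  have hδ' : (0 : ℝ) < δ := by exact_mod_cast hδ
  have hxp : 0 < ‖x - w‖ := hδ'.trans_le hx
  have hyp : 0 < ‖y - w‖ := hδ'.trans_le hy
  have hρ : (0 : ℝ) ≤ ρ := ρ.coe_nonneg
  set a := max 1 ((ρ : ℝ) / ‖x - w‖)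
  set b := max 1 ((ρ : ℝ) / ‖y - w‖)
  have ha0 : 0 ≤ a := zero_le_one.trans (le_max_left _ _)
  have ha : a ≤ 1 + ρ / δ := by
    refine max_le (by simp; positivity) ?_
    have : (ρ : ℝ) / ‖x - w‖ ≤ ρ / δ := by gcongr; exact hx
    linarith
  have hnorm : |‖y - w‖ - ‖x - w‖| ≤ ‖x - y‖ := by
    have := abs_norm_sub_norm_le (y - w) (x - w)
    rwa [sub_sub_sub_cancel_right, norm_sub_rev y x] at this
  have hab : |a - b| * ‖y - w‖ ≤ ρ / δ * ‖x - y‖ := by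
    have h1 : |a - b| ≤ |(ρ : ℝ) / ‖x - w‖ - ρ / ‖y - w‖| := by
      have := abs_max_sub_max_le_abs ((ρ : ℝ) / ‖x - w‖) (ρ / ‖y - w‖) 1
      rwa [max_comm _ 1, max_comm _ 1] at this
    have h2 : (ρ : ℝ) / ‖x - w‖ - ρ / ‖y - w‖ =
        ρ / ‖x - w‖ * (‖y - w‖ - ‖x - w‖) / ‖y - w‖ := by
      field_simp
    have h3 : |(ρ : ℝ) / ‖x - w‖ - ρ / ‖y - w‖| * ‖y - w‖ =
        ρ / ‖x - w‖ * |‖y - w‖ - ‖x - w‖| := by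
      rw [h2, abs_div, abs_mul, abs_of_pos hyp, abs_of_nonneg (by positivity),
        div_mul_cancel₀ _ hyp.ne']
    calc |a - b| * ‖y - w‖ ≤ |(ρ : ℝ) / ‖x - w‖ - ρ / ‖y - w‖| * ‖y - w‖ := by gcongr
      _ = ρ / ‖x - w‖ * |‖y - w‖ - ‖x - w‖| := h3
      _ ≤ ρ / δ * ‖x - y‖ := by
          gcongr
          exact hx
  have key : radialPush w ρ x - radialPush w ρ y = a • (x - y) + (a - b) • (y - w) := by
    simp only [radialPush]
    module
  rw [dist_eq_norm, key, dist_eq_norm]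
  calc ‖a • (x - y) + (a - b) • (y - w)‖ ≤ ‖a • (x - y)‖ + ‖(a - b) • (y - w)‖ :=
        norm_add_le _ _
    _ = a * ‖x - y‖ + |a - b| * ‖y - w‖ := by
        rw [norm_smul, norm_smul, Real.norm_of_nonneg ha0, Real.norm_eq_abs]
    _ ≤ (1 + ρ / δ) * ‖x - y‖ + ρ / δ * ‖x - y‖ := by gcongr
    _ = _ := by push_cast; ring

/-! ### Surjectivity of maps equal to the identity off a ball -/

variable [FiniteDimensional ℝ E]

/-- Prepares the retraction argument around an omitted value w: a large ball about w is preserved,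
and compactness keeps the image of F a positive distance from w. -/
theorem exists_closedBall_supset_and_bound {F : E → E} (hF : Continuous F) {r : ℝ}
    (hid : ∀ x ∉ closedBall (0 : E) r, F x = x) {w : E} (hw : ∀ x, F x ≠ w) :
    ∃ ρ : ℝ, 0 < ρ ∧ (∀ x ∉ closedBall w ρ, F x = x) ∧
      MapsTo F (closedBall w ρ) (closedBall w ρ) ∧ ∃ δ : ℝ, 0 < δ ∧ ∀ x, δ ≤ ‖F x - w‖ := by
  obtain ⟨M, hM⟩ := (((isCompact_closedBall (0 : E) r).image hF).isBounded.union
    (isBounded_closedBall (x := (0 : E)) (r := r))).subset_closedBall w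
  set ρ := max M 1 with hρ
  have hρ0 : 0 < ρ := zero_lt_one.trans_le (le_max_right _ _)
  have hsub : closedBall w M ⊆ closedBall w ρ := closedBall_subset_closedBall (le_max_left _ _)
  have hout : ∀ x ∉ closedBall w ρ, F x = x := fun x hx =>
    hid x fun hx' => hx (hsub (hM (Or.inr hx')))
  have hmaps : MapsTo F (closedBall w ρ) (closedBall w ρ) := by
    intro x hx
    by_cases hxr : x ∈ closedBall (0 : E) r
    · exact hsub (hM (Or.inl (mem_image_of_mem F hxr)))
    · rwa [hid x hxr]
  refine ⟨ρ, hρ0, hout, hmaps, ?_⟩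
  obtain ⟨x₀, hx₀, hmin⟩ := (isCompact_closedBall w ρ).exists_isMinOn
    ⟨w, mem_closedBall_self hρ0.le⟩ (f := fun x => ‖F x - w‖) (by fun_prop)
  refine ⟨‖F x₀ - w‖, norm_pos_iff.2 (sub_ne_zero.2 (hw x₀)), fun x => ?_⟩
  by_cases hx : x ∈ closedBall w ρ
  · exact hmin hx
  · have h1 : ‖F x₀ - w‖ ≤ ρ := by
      have := hmaps hx₀
      rwa [mem_closedBall, dist_eq_norm] at this
    rw [hout x hx]
    rw [mem_closedBall, dist_eq_norm, not_le] at hx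
    exact h1.trans hx.le

/-- If w were omitted, pushing F radially away from w would give a Lipschitz retraction of a ball
onto its sphere. -/
theorem LipschitzWith.surjective_of_eq_id_off_closedBall {F : E → E} {C : ℝ≥0}
    (hF : LipschitzWith C F) {r : ℝ} (hid : ∀ x ∉ closedBall (0 : E) r, F x = x) :
    Function.Surjective F := by
  intro w
  by_contra! hw
  obtain ⟨ρ, hρ, hout, hmaps, δ, hδ, hFδ⟩ :=
    exists_closedBall_supset_and_bound hF.continuous hid hw
  lift ρ to ℝ≥0 using hρ.le
  lift δ to ℝ≥0 using hδ.le
  have hlip : LipschitzWith _ (radialPush w ρ ∘ F) :=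
    lipschitzOnWith_univ.1 <| (lipschitzOnWith_radialPush w (ρ := ρ)
      (by exact_mod_cast hδ)).comp hF.lipschitzOnWith fun x _ => hFδ x
  refine not_norm_sub_eq_of_lipschitz hlip hρ (c := w) ?_ ?_
  · intro x hx
    rw [Function.comp_apply, hout x hx]
    rw [mem_closedBall, dist_eq_norm, not_le] at hx
    exact radialPush_of_le hx.le
  · intro x hx
    have := hmaps hx
    rw [mem_closedBall, dist_eq_norm] at this
    exact norm_radialPush_sub (hw x) this

/-- An omitted value w is missed by some δ > 0. A smooth approximation of F within δ/2 is surjective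
by the Lipschitz case and hits w, so F comes within δ/2 of w. -/
theorem Continuous.surjective_of_eq_id_off_closedBall {F : E → E}
    (hF : Continuous F) {r : ℝ} (hid : ∀ x ∉ closedBall (0 : E) r, F x = x) :
    Function.Surjective F := by
  intro w
  by_contra! hw
  obtain ⟨-, -, -, -, δ, hδ, hFδ⟩ := exists_closedBall_supset_and_bound hF hid hw
  set h : E → E := fun x => F x - x with hh
  have hc : Continuous h := hF.sub continuous_id
  have hsupp : HasCompactSupport h :=
    HasCompactSupport.intro (isCompact_closedBall (0 : E) r) fun x hx => by
      simp [hh, hid x hx]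
  have hu : UniformContinuous h := hsupp.uniformContinuous_of_continuous hc
  obtain ⟨η, hη, hηu⟩ := Metric.uniformContinuous_iff.1 hu (δ / 2) (half_pos hδ)
  -- Smoothing scale η controls the error; scale at most 1 makes g vanish exactly off the ball of
  -- radius r + 1.
  obtain ⟨g, hg, hgd⟩ := hc.exists_contDiff_dist_le_of_forall_mem_ball_dist_le
    (lt_min hη one_pos)
  have hgh : ∀ x, dist (g x) (h x) ≤ δ / 2 := fun x =>
    hgd x _ fun y hy => (hηu ((mem_ball.1 hy).trans_le (min_le_left _ _))).le
  have hg0 : ∀ x ∉ closedBall (0 : E) (r + 1), g x = 0 := by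
    intro x hx
    rw [mem_closedBall_zero_iff, not_le] at hx
    have hhx : h x = 0 := by
      simp only [hh, hid x (by rw [mem_closedBall_zero_iff]; linarith), sub_self]
    have := hgd x 0 fun y hy => by
      have hy1 : dist y x < 1 := (mem_ball.1 hy).trans_le (min_le_right _ _)
      have hyr : y ∉ closedBall (0 : E) r := by
        rw [mem_closedBall_zero_iff, not_le]
        have := norm_sub_norm_le x y
        rw [← dist_eq_norm, dist_comm] at this
        linarith
      have : h y = 0 := by simp only [hh, hid y hyr, sub_self]
      rw [this, hhx, dist_self]
    rw [hhx] at this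
    exact dist_le_zero.1 this
  obtain ⟨C, hC⟩ := hg.lipschitzWith_of_hasCompactSupport
    (HasCompactSupport.intro (isCompact_closedBall (0 : E) (r + 1)) hg0) (by simp)
  obtain ⟨x, hx⟩ := (LipschitzWith.id.add hC).surjective_of_eq_id_off_closedBall
    (r := r + 1) (fun x hx => by simp [hg0 x hx]) w
  have h1 := hFδ x
  have h2 := hgh x
  have hx' : x + g x = w := hx
  rw [dist_eq_norm, ← norm_neg] at h2
  have h3 : -(g x - h x) = F x - w := by
    rw [← hx', hh]; simp only; abel
  rw [h3] at h2
  linarith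

/-! ### Invariance of domain and covering by expanding maps -/

/-- Invariance of domain for continuous maps with Lipschitz inverse. -/
theorem image_closedBall_mem_nhds_of_expanding {f : E → E} (hf : Continuous f) {m s : ℝ}
    (hm : 0 < m) (hs : 0 < s) {x₀ : E}
    (hexp : ∀ x ∈ closedBall x₀ s, ∀ y ∈ closedBall x₀ s, m * ‖x - y‖ ≤ ‖f x - f y‖) :
    f '' closedBall x₀ s ∈ 𝓝 (f x₀) := by
  by_contra hnot
  set B := closedBall x₀ s with hB
  -- On the boundary sphere f x is at distance at least 4ε from f x₀, hence at least ε from any c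
  -- within ε of f x₀.
  set ε := m * s / 4 with hε
  have hε0 : 0 < ε := by positivity
  have hx₀ : x₀ ∈ B := mem_closedBall_self hs.le
  obtain ⟨c, hcε, hcB⟩ : ∃ c ∈ ball (f x₀) ε, c ∉ f '' B := by
    by_contra! hall
    exact hnot (Filter.mem_of_superset (ball_mem_nhds _ hε0) hall)
  have hcε' : ‖f x₀ - c‖ < ε := by
    rwa [mem_ball, dist_comm, dist_eq_norm] at hcε
  have hinj : InjOn f B := by
    intro x hx y hy hxy
    have := hexp x hx y hy
    rw [hxy, sub_self, norm_zero] at this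
    have : ‖x - y‖ ≤ 0 := by
      by_contra! h
      nlinarith [mul_pos hm h]
    exact sub_eq_zero.1 (norm_le_zero_iff.1 this)
  obtain ⟨G, hGlip, hG⟩ : ∃ G : E → E, (∃ C, LipschitzWith C G) ∧ ∀ x ∈ B, G (f x) = x := by
    have hinv : LipschitzOnWith (Real.toNNReal m⁻¹) (Function.invFunOn f B) (f '' B) := by
      refine LipschitzOnWith.of_dist_le_mul ?_
      rintro _ ⟨x, hx, rfl⟩ _ ⟨y, hy, rfl⟩
      rw [hinj.leftInvOn_invFunOn hx, hinj.leftInvOn_invFunOn hy, dist_eq_norm,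
        dist_eq_norm, Real.coe_toNNReal _ (inv_nonneg.2 hm.le), ← div_eq_inv_mul,
        le_div_iff₀ hm, mul_comm]
      exact hexp x hx y hy
    obtain ⟨G, hG, hGeq⟩ := hinv.extend_finite_dimension
    refine ⟨G, ⟨_, hG⟩, fun x hx => ?_⟩
    rw [← hGeq (mem_image_of_mem f hx), hinj.leftInvOn_invFunOn hx]
  obtain ⟨C, hGC⟩ := hGlip
  classical
  -- Points whose image lies within ε of the omitted value c are sent into G(sphere), a null set;
  -- all other points are fixed. So F misses almost all of the nonempty open set where ‖f w - c‖ <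
  -- ε, although it must be surjective.
  set F : E → E := fun x => if ‖x - x₀‖ ≤ s then G (radialPush c ε (f x)) else x with hFdef
  have hmemB : ∀ x, x ∈ B ↔ ‖x - x₀‖ ≤ s := fun x => by rw [hB, mem_closedBall, dist_eq_norm]
  have hFin : ∀ x ∈ B, F x = G (radialPush c ε (f x)) := fun x hx =>
    if_pos ((hmemB x).1 hx)
  have hFout : ∀ x ∉ B, F x = x := fun x hx => if_neg fun h => hx ((hmemB x).2 h)
  have hfar : ∀ x ∈ B, ε ≤ ‖f x - c‖ → F x = x := fun x hx h => by
    rw [hFin x hx, radialPush_of_le h, hG x hx]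
  have hFcont : Continuous F := by
    refine continuous_if_le (by fun_prop) continuous_const ?_ continuousOn_id ?_
    · intro x hx
      have hxB : x ∈ B := (hmemB x).2 hx
      have : f x ≠ c := fun h => hcB ⟨x, hxB, h⟩
      exact (hGC.continuous.continuousAt.comp
        ((continuousAt_radialPush this).comp hf.continuousAt)).continuousWithinAt
    · intro x hx
      have hxB : x ∈ B := (hmemB x).2 hx.le
      rw [← hFin x hxB]
      refine hfar x hxB ?_
      have h1 := hexp x hxB x₀ hx₀
      have h2 : ‖f x - f x₀‖ ≤ ‖f x - c‖ + ‖f x₀ - c‖ := by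
        rw [← sub_sub_sub_cancel_right (f x) (f x₀) c]
        exact norm_sub_le _ _
      rw [hx] at h1
      linarith
  obtain ⟨r, hr⟩ := (isBounded_closedBall (x := x₀) (r := s)).subset_closedBall (0 : E)
  have hsurj := hFcont.surjective_of_eq_id_off_closedBall (r := r)
    fun x hx => hFout x fun h => hx (hr h)
  borelize E
  set μ : Measure E := μH[finrank ℝ E]
  have hnull : μ (G '' sphere c ε) = 0 :=
    hGC.hausdorffMeasure_image_eq_zero (Measure.addHaar_sphere_of_ne_zero μ c hε0.ne')
  obtain ⟨w, ⟨hwB, hwε⟩, hwG⟩ : ∃ w ∈ ball x₀ s ∩ {w | ‖f w - c‖ < ε}, w ∉ G '' sphere c ε := by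
    by_contra! hall
    have hopen : IsOpen (ball x₀ s ∩ {w | ‖f w - c‖ < ε}) :=
      isOpen_ball.inter (isOpen_lt (by fun_prop) continuous_const)
    exact (hopen.measure_pos μ ⟨x₀, mem_ball_self hs, hcε'⟩).ne'
      (measure_mono_null hall hnull)
  obtain ⟨x, hx⟩ := hsurj w
  have hwB' : w ∈ B := ball_subset_closedBall hwB
  by_cases hxB : x ∈ B
  · by_cases hxε : ε ≤ ‖f x - c‖
    · rw [hfar x hxB hxε] at hx
      rw [hx] at hxε
      exact absurd hwε (not_lt.2 hxε)
    · rw [hFin x hxB] at hx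
      refine hwG ⟨_, ?_, hx⟩
      rw [mem_sphere, dist_eq_norm]
      exact norm_radialPush_sub (fun h => hcB ⟨x, hxB, h⟩) (not_le.1 hxε).le
  · rw [hFout x hxB] at hx
    exact hxB (hx ▸ hwB')

/-- A continuous expanding map on a ball covers the ball with radius scaled by the
expansion constant. -/
theorem closedBall_subset_image_of_expanding {f : E → E} (hf : Continuous f) {m r : ℝ}
    (hm : 0 < m) (hr : 0 < r) {z : E}
    (hexp : ∀ x ∈ closedBall z r, ∀ y ∈ closedBall z r, m * ‖x - y‖ ≤ ‖f x - f y‖) :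
    closedBall (f z) (m * r) ⊆ f '' closedBall z r := by
  have hclosed : IsClosed (f '' closedBall z r) :=
    ((isCompact_closedBall z r).image hf).isClosed
  rw [← closure_ball _ (mul_pos hm hr).ne']
  refine closure_minimal ?_ hclosed
  have hz : z ∈ closedBall z r := mem_closedBall_self hr.le
  have hint : ∀ x ∈ ball z r, f x ∈ interior (f '' closedBall z r) := by
    intro x hx
    have hsub : closedBall x (r - dist x z) ⊆ closedBall z r :=
      closedBall_subset_closedBall' (by simp)
    rw [mem_interior_iff_mem_nhds]
    exact Filter.mem_of_superset (image_closedBall_mem_nhds_of_expanding hf hm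
      (sub_pos.2 hx) fun a ha b hb => hexp a (hsub ha) b (hsub hb)) (image_mono hsub)
  -- The interior of the image is relatively closed in the connected open ball: a limit point there
  -- is some f x with m‖x - z‖ < mr, so x is interior to the domain ball.
  refine ((convex_ball (f z) (m * r)).isPreconnected.subset_of_closure_inter_subset
    isOpen_interior ⟨f z, mem_ball_self (mul_pos hm hr), hint z (mem_ball_self hr)⟩ ?_).trans
    interior_subset
  rintro y ⟨hy, hyb⟩
  obtain ⟨x, hx, rfl⟩ := closure_minimal interior_subset hclosed hy
  refine hint x ?_
  rw [mem_ball, dist_eq_norm] at hyb ⊢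
  have := hexp x hx z hz
  exact lt_of_mul_lt_mul_left (this.trans_lt hyb) hm.le

/-- Expanding balls around zeros of a continuous map have the same center once they share a point
with small image. -/
theorem eq_of_expanding_of_mem_closedBall {f : E → E} (hf : Continuous f) {m r : ℝ}
    (hm : 0 < m) {z w p : E} (hz : f z = 0) (hw : f w = 0)
    (hexpz : ∀ x ∈ closedBall z r, ∀ y ∈ closedBall z r, m * ‖x - y‖ ≤ ‖f x - f y‖)
    (hexpw : ∀ x ∈ closedBall w r, ∀ y ∈ closedBall w r, m * ‖x - y‖ ≤ ‖f x - f y‖)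
    (hpz : p ∈ closedBall z r) (hpw : p ∈ closedBall w r) (hp : ‖f p‖ < m * r) : z = w := by
  have hr : 0 < r := by
    by_contra! h
    nlinarith [norm_nonneg (f p)]
  have hdist : ∀ c : E, f c = 0 →
      (∀ x ∈ closedBall c r, ∀ y ∈ closedBall c r, m * ‖x - y‖ ≤ ‖f x - f y‖) →
      ∀ x ∈ closedBall c r, m * ‖x - c‖ ≤ ‖f x‖ := by
    intro c hc hexp x hx
    simpa [hc] using hexp x hx c (mem_closedBall_self hr.le)
  have hball : ∀ x, x ∈ closedBall z r ∩ closedBall w r → ‖f x‖ < m * r →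
      x ∈ ball z r ∩ ball w r := by
    intro x hx hfx
    simp only [mem_inter_iff, mem_ball, dist_eq_norm]
    exact ⟨lt_of_mul_lt_mul_left ((hdist z hz hexpz x hx.1).trans_lt hfx) hm.le,
      lt_of_mul_lt_mul_left ((hdist w hw hexpw x hx.2).trans_lt hfx) hm.le⟩
  have hopen : IsOpen (f '' (ball z r ∩ ball w r)) := by
    rw [isOpen_iff_mem_nhds]
    rintro _ ⟨x, hx, rfl⟩
    obtain ⟨s, hs, hsub⟩ := nhds_basis_closedBall.mem_iff.1
      ((isOpen_ball.inter isOpen_ball).mem_nhds hx)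
    exact Filter.mem_of_superset (image_closedBall_mem_nhds_of_expanding hf hm hs
      fun a ha b hb => hexpz a (ball_subset_closedBall (hsub ha).1) b
        (ball_subset_closedBall (hsub hb).1)) (image_mono hsub)
  have hclosed : IsClosed (f '' (closedBall z r ∩ closedBall w r)) :=
    (((isCompact_closedBall z r).inter_right isClosed_closedBall).image hf).isClosed
  -- The image of the intersection of the open balls is relatively clopen in this connected ball and
  -- contains f p. It therefore contains 0, and expansion makes the zero q equal to both centres.
  have hsub : ball (0 : E) (m * r) ⊆ f '' (ball z r ∩ ball w r) := by
    refine (convex_ball (0 : E) (m * r)).isPreconnected.subset_of_closure_inter_subset hopen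
      ⟨f p, by simpa using hp, mem_image_of_mem f (hball p ⟨hpz, hpw⟩ hp)⟩ ?_
    rintro y ⟨hy, hyb⟩
    obtain ⟨x, hx, rfl⟩ := closure_minimal (image_mono (inter_subset_inter
      ball_subset_closedBall ball_subset_closedBall)) hclosed hy
    exact mem_image_of_mem f (hball x hx (by simpa using hyb))
  obtain ⟨q, ⟨hqz, hqw⟩, hq⟩ := hsub (mem_ball_self (mul_pos hm hr))
  have hcenter : ∀ c : E, m * ‖q - c‖ ≤ ‖f q‖ → q = c := by
    intro c hc
    rw [hq, norm_zero] at hc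
    have : ‖q - c‖ ≤ 0 := by
      by_contra! h
      nlinarith [mul_pos hm h]
    exact sub_eq_zero.1 (norm_le_zero_iff.1 this)
  rw [← hcenter z (hdist z hz hexpz q (ball_subset_closedBall hqz)),
    ← hcenter w (hdist w hw hexpw q (ball_subset_closedBall hqw))]

end Surjectivity

/-! ### Contractions for the supremum metric -/

open Filter in
/-- Banach's fixed point theorem for the supremum metric on a possibly infinite product. -/
theorem exists_fixedPoint_of_sup_contracting {ι E : Type*} [NormedAddCommGroup E]
    [CompleteSpace E] {X : Set (ι → E)} (hX : IsClosed X) {T : (ι → E) → ι → E}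
    (hT : MapsTo T X X) {q C : ℝ} (hq0 : 0 ≤ q) (hq1 : q < 1)
    (hcontr : ∀ u ∈ X, ∀ w ∈ X, ∀ D : ℝ, (∀ i, ‖u i - w i‖ ≤ D) →
      ∀ i, ‖T u i - T w i‖ ≤ q * D)
    {u₀ : ι → E} (hu₀ : u₀ ∈ X) (hC : ∀ i, ‖u₀ i - T u₀ i‖ ≤ C) :
    ∃ u ∈ X, T u = u := by
  set U : ℕ → ι → E := fun n => T^[n] u₀ with hU
  have hsucc : ∀ n, U (n + 1) = T (U n) := fun n => Function.iterate_succ_apply' T n u₀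
  have hUX : ∀ n, U n ∈ X := fun n => hT.iterate n hu₀
  have hstep : ∀ n i, ‖U n i - U (n + 1) i‖ ≤ C * q ^ n := by
    intro n
    induction n with
    | zero => simpa [hU] using hC
    | succ n ih =>
      intro i
      have := hcontr _ (hUX n) _ (hUX (n + 1)) _ ih i
      rw [← hsucc, ← hsucc] at this
      calc _ ≤ _ := this
        _ = _ := by ring
  have hstep' : ∀ i n, dist (U n i) (U (n + 1) i) ≤ C * q ^ n := fun i n => by
    rw [dist_eq_norm]; exact hstep n i
  choose u hu using fun i =>
    cauchySeq_tendsto_of_complete (cauchySeq_of_le_geometric q C hq1 (hstep' i))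
  have huX : u ∈ X := hX.mem_of_tendsto (tendsto_pi_nhds.2 hu) (Eventually.of_forall hUX)
  refine ⟨u, huX, funext fun i => ?_⟩
  -- This bound is uniform in i, so the contraction hypothesis applies to the pair U n, u, although
  -- u was built only as a pointwise limit.
  have hlim : ∀ n i, ‖U n i - u i‖ ≤ C * q ^ n / (1 - q) := fun n i => by
    rw [← dist_eq_norm]
    exact dist_le_of_le_geometric_of_tendsto q C hq1 (hstep' i) (hu i) n
  have hTu : Tendsto (fun n => U (n + 1) i) atTop (𝓝 (T u i)) := by
    rw [tendsto_iff_norm_sub_tendsto_zero]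
    have h0 : Tendsto (fun n => q * (C * q ^ n / (1 - q))) atTop (𝓝 0) := by
      have := (tendsto_pow_atTop_nhds_zero_of_lt_one hq0 hq1).const_mul C
      simpa using (this.div_const (1 - q)).const_mul q
    refine squeeze_zero (fun _ => norm_nonneg _) (fun n => ?_) h0
    rw [hsucc]
    exact hcontr _ (hUX n) _ huX _ (hlim n) i
  exact tendsto_nhds_unique hTu ((tendsto_add_atTop_iff_nat 1).2 (hu i))

/-! ### Existence and uniqueness of solutions -/

namespace AntiIntegrable

variable {s d : ℕ}

theorem supDist_le_ofReal {u v : Config s d} {D : ℝ} (hD : 0 ≤ D) :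
    supDist u v ≤ ENNReal.ofReal D ↔ ∀ i, ‖u i - v i‖ ≤ D := by
  simp only [supDist, iSup_le_iff, edist_dist, ENNReal.ofReal_le_ofReal_iff hD, dist_eq_norm]

/-- Shifting a homomorphism by i is the same as translating it by ρ i, so horizontal and vertical
invariance together make Δρ constant. -/
theorem IsInvariant.apply_hom {Δ : Config s d → Config s d} (hΔ : IsInvariant Δ)
    (ρ : LatticeHom s d) (i : Lattice s) : Δ ρ i = onHom Δ ρ := by
  have h : shift i (ρ : Config s d) = translate (ρ i) ρ := by
    ext1 j
    simp [shift, translate]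
  have h1 := congrFun (hΔ.horizontal i ρ) 0
  rw [h, hΔ.vertical] at h1
  simpa [shift, onHom] using h1.symm

theorem IsLipschitzOn.norm_sub_le {Δ : Config s d → Config s d} {K : ℝ}
    {A : Set (Config s d)} (h : IsLipschitzOn Δ K A) {u v : Config s d} (hu : u ∈ A) (hv : v ∈ A)
    {D : ℝ} (hD : ∀ i, ‖u i - v i‖ ≤ D) (i : Lattice s) : ‖Δ u i - Δ v i‖ ≤ K * D := by
  have hD0 : 0 ≤ D := (norm_nonneg _).trans (hD i)
  refine (supDist_le_ofReal (mul_nonneg h.1.le hD0)).1 ?_ i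
  rw [ENNReal.ofReal_mul h.1.le]
  exact (h.2 u hu v hv).trans (by gcongr; exact (supDist_le_ofReal hD0).2 hD)

/-- Two nearby solutions in the region of contraction coincide. -/
theorem eq_of_inCommonBalls {Δ : Config s d → Config s d} {ψ : Space d → Space d}
    {O : Set (Space d)} {R r m K lam : ℝ} (hψ : AubryCriterion ψ O R r m) {A : Set (Config s d)}
    (hK : IsLipschitzOn Δ K A) (hlam : 0 < lam) (hKlam : K < lam * m) {u v : Config s d}
    (hu : u ∈ A) (hv : v ∈ A) (hueq : ∀ i, Δ u i + lam • ψ (u i) = 0)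
    (hveq : ∀ i, Δ v i + lam • ψ (v i) = 0) (huv : InCommonBalls O r u v) : u = v := by
  have hm := hψ.m_pos
  set q := K / (lam * m) with hq
  have hlm : 0 < lam * m := mul_pos hlam hm
  have hq0 : 0 ≤ q := div_nonneg hK.1.le hlm.le
  have hq1 : q < 1 := (div_lt_one hlm).2 hKlam
  have hcontr : ∀ D, (∀ i, ‖u i - v i‖ ≤ D) → ∀ i, ‖u i - v i‖ ≤ q * D := by
    intro D hD i
    obtain ⟨x, hx, hux, hvx⟩ := huv i
    have h1 : lam * m * ‖u i - v i‖ ≤ K * D := by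
      calc lam * m * ‖u i - v i‖ = lam * (m * ‖u i - v i‖) := by ring
        _ ≤ lam * ‖ψ (u i) - ψ (v i)‖ := by gcongr; exact hψ.expanding x hx _ hux _ hvx
        _ = ‖lam • ψ (u i) - lam • ψ (v i)‖ := by
            rw [← smul_sub, norm_smul, Real.norm_of_nonneg hlam.le]
        _ = ‖Δ u i - Δ v i‖ := by
            rw [eq_neg_of_add_eq_zero_right (hueq i), eq_neg_of_add_eq_zero_right (hveq i),
              neg_sub_neg, norm_sub_rev]
        _ ≤ K * D := hK.norm_sub_le hu hv hD i
    rw [hq, div_mul_eq_mul_div, le_div_iff₀ hlm]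
    linarith
  -- Common balls give the finite initial bound 2r, which the contraction then improves
  -- geometrically.
  have hbound : ∀ n : ℕ, ∀ i, ‖u i - v i‖ ≤ q ^ n * (r + r) := by
    intro n
    induction n with
    | zero =>
      intro i
      obtain ⟨x, -, hux, hvx⟩ := huv i
      rw [pow_zero, one_mul, ← dist_eq_norm]
      exact (dist_triangle_right _ _ x).trans (add_le_add hux hvx)
    | succ n ih => intro i; rw [pow_succ', mul_assoc]; exact hcontr _ ih i
  ext1 i
  have hlim : Filter.Tendsto (fun n : ℕ => q ^ n * (r + r)) Filter.atTop (𝓝 0) := by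
    simpa using (tendsto_pow_atTop_nhds_zero_of_lt_one hq0 hq1).mul_const (r + r)
  have : ‖u i - v i‖ ≤ 0 := ge_of_tendsto' hlim fun n => hbound n i
  exact sub_eq_zero.1 (norm_le_zero_iff.1 this)

/-- A solution staying close to prescribed zeros of the pointwise function near `ρ`. -/
theorem exists_solution_near_zeros {Δ : Config s d → Config s d} {ψ : Space d → Space d}
    {O : Set (Space d)} {R r m K lam : ℝ} (hψ : AubryCriterion ψ O R r m) {A : Set (Config s d)}
    (hK : IsLipschitzOn Δ K A) (hlam : 0 < lam) (hKlam : K < lam * m) {v : Config s d}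
    (hv : ∀ i, v i ∈ O) (hA : (univ.pi fun i => Metric.closedBall (v i) r) ⊆ A)
    (hΔ : ∀ u ∈ univ.pi fun i => Metric.closedBall (v i) r, ∀ i, ‖Δ u i‖ ≤ lam * (m * r)) :
    ∃ u : Config s d, (∀ i, u i ∈ Metric.closedBall (v i) r) ∧
      ∀ i, Δ u i + lam • ψ (u i) = 0 := by
  have hm := hψ.m_pos
  have hr := hψ.r_pos
  have hlm : 0 < lam * m := mul_pos hlam hm
  set X : Set (Config s d) := univ.pi fun i => Metric.closedBall (v i) r with hX
  -- One step of the iteration: ψ covers the ball of radius mr about 0 from each ball about v i. Off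
  -- X the value is irrelevant.
  have hsolve : ∀ u : Config s d, ∃ u' : Config s d, u ∈ X →
      u' ∈ X ∧ ∀ i, lam • ψ (u' i) = -Δ u i := by
    intro u
    by_cases hu : u ∈ X
    · have : ∀ i, ∃ y ∈ Metric.closedBall (v i) r, ψ y = -(lam⁻¹ • Δ u i) := by
        intro i
        refine closedBall_subset_image_of_expanding hψ.continuous hm hr
          (hψ.expanding (v i) (hv i)) ?_
        rw [hψ.zero _ (hv i), mem_closedBall_zero_iff, norm_neg, norm_smul, norm_inv,
          Real.norm_of_nonneg hlam.le, inv_mul_le_iff₀ hlam]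
        exact hΔ u hu i
      choose u' hu' hψu' using this
      refine ⟨u', fun _ => ⟨fun i _ => hu' i, fun i => ?_⟩⟩
      rw [hψu', smul_neg, smul_inv_smul₀ hlam.ne']
    · exact ⟨u, fun h => absurd h hu⟩
  choose T hT using hsolve
  have hXdist : ∀ u ∈ X, ∀ w ∈ X, ∀ i, ‖u i - w i‖ ≤ r + r := by
    intro u hu w hw i
    rw [← dist_eq_norm]
    exact (dist_triangle_right _ _ (v i)).trans
      (add_le_add (hu i (mem_univ i)) (hw i (mem_univ i)))
  have hvX : v ∈ X := fun i _ => Metric.mem_closedBall_self hr.le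
  have hcontr : ∀ u ∈ X, ∀ w ∈ X, ∀ D : ℝ, (∀ i, ‖u i - w i‖ ≤ D) →
      ∀ i, ‖T u i - T w i‖ ≤ K / (lam * m) * D := by
    intro u hu w hw D hD i
    have h1 : lam * m * ‖T u i - T w i‖ ≤ K * D := by
      calc lam * m * ‖T u i - T w i‖ = lam * (m * ‖T u i - T w i‖) := by ring
        _ ≤ lam * ‖ψ (T u i) - ψ (T w i)‖ := by
            gcongr
            exact hψ.expanding (v i) (hv i) _ ((hT u hu).1 i (mem_univ i)) _
              ((hT w hw).1 i (mem_univ i))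
        _ = ‖lam • ψ (T u i) - lam • ψ (T w i)‖ := by
            rw [← smul_sub, norm_smul, Real.norm_of_nonneg hlam.le]
        _ = ‖Δ u i - Δ w i‖ := by
            rw [(hT u hu).2, (hT w hw).2, neg_sub_neg, norm_sub_rev]
        _ ≤ K * D := hK.norm_sub_le (hA hu) (hA hw) hD i
    rw [div_mul_eq_mul_div, le_div_iff₀ hlm]
    linarith
  obtain ⟨u, hu, hfix⟩ := exists_fixedPoint_of_sup_contracting (X := X) (T := T)
    (q := K / (lam * m)) (C := r + r) (u₀ := v)
    (isClosed_set_pi fun _ _ => Metric.isClosed_closedBall) (fun u hu => (hT u hu).1)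
    (div_nonneg hK.1.le hlm.le) ((div_lt_one hlm).2 hKlam) hcontr hvX
    (hXdist v hvX (T v) (hT v hvX).1)
  refine ⟨u, fun i => hu i (mem_univ i), fun i => ?_⟩
  have := (hT u hu).2 i
  rw [hfix] at this
  rw [this, add_neg_cancel]

end AntiIntegrable

theorem theorem3p1 {s d : ℕ}
    (Δ Ψ : AntiIntegrable.Config s d → AntiIntegrable.Config s d)
    (ψ : AntiIntegrable.Space d → AntiIntegrable.Space d)
    (hΔ : AntiIntegrable.IsInvariant Δ)
    (hΨ : AntiIntegrable.IsPointwise Ψ ψ)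
    (K : AntiIntegrable.LatticeHom s d → ℝ → ℝ)
    (hK : ∀ (ρ : AntiIntegrable.LatticeHom s d) (R' : ℝ), 0 < R' →
      AntiIntegrable.IsLipschitzOn Δ (K ρ R') (AntiIntegrable.closedBall (⇑ρ) R'))
    (O : Set (AntiIntegrable.Space d)) (R r m : ℝ)
    (hψ : AntiIntegrable.AubryCriterion ψ O R r m)
    (ρ : AntiIntegrable.LatticeHom s d) (lam : ℝ)
    (hlam : AntiIntegrable.threshold Δ ρ (K ρ (r + R)) R r m ≤ lam) :
    ∃ u : AntiIntegrable.Config s d,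
      (Δ + lam • Ψ) u = 0 ∧
      (⨆ i, Metric.infEDist (u i) O) ≤ ENNReal.ofReal r ∧
      AntiIntegrable.supDist u (⇑ρ) ≤ ENNReal.ofReal (r + R) ∧
      (AntiIntegrable.threshold Δ ρ (K ρ (r + R)) R r m < lam →
        ∀ u' : AntiIntegrable.Config s d, (Δ + lam • Ψ) u' = 0 →
          AntiIntegrable.InCommonBalls O r u u' → u = u') ∧
      (∀ u' : AntiIntegrable.Config s d, (Δ + lam • Ψ) u' = 0 →
        AntiIntegrable.InCommonBalls O r u u' →
        AntiIntegrable.supDist u' (⇑ρ) ≤ ENNReal.ofReal (r + R) → u = u') := by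
  set K₀ := K ρ (r + R) with hK₀
  have hm := hψ.m_pos
  have hr := hψ.r_pos
  have hR := hψ.R_pos
  have hrR : 0 < r + R := add_pos hr hR
  have hK' := hK ρ (r + R) hrR
  rw [← hK₀] at hK'
  have hKpos : 0 < K₀ := hK'.1
  set h₀ := AntiIntegrable.onHom Δ ρ with hh₀
  have hthr : K₀ * (r + R) + ‖h₀‖ ≤ lam * (r * m) := (div_le_iff₀ (mul_pos hr hm)).1 hlam
  have hlam0 : 0 < lam := by
    by_contra! h
    nlinarith [mul_pos hr hm, mul_pos hKpos hrR, norm_nonneg h₀]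
  -- Strict because R > 0: the threshold gives K₀(r + R) ≤ λmr, and K₀R > 0.
  have hKlam : K₀ < lam * m := by
    by_contra! h
    nlinarith [mul_pos hKpos hR, norm_nonneg h₀]
  choose v hvO hvR using fun i => hψ.dense (ρ i)
  have hnear : ∀ u : AntiIntegrable.Config s d, (∀ i, u i ∈ Metric.closedBall (v i) r) →
      ∀ i, ‖u i - ρ i‖ ≤ r + R := by
    intro u hu i
    rw [← dist_eq_norm]
    exact (dist_triangle _ (v i) _).trans (add_le_add (hu i) (hvR i))
  have hmemA : ∀ u : AntiIntegrable.Config s d, (∀ i, ‖u i - ρ i‖ ≤ r + R) →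
      u ∈ AntiIntegrable.closedBall (⇑ρ) (r + R) := fun u hu =>
    (AntiIntegrable.supDist_le_ofReal hrR.le).2 hu
  have hρA : (ρ : AntiIntegrable.Config s d) ∈ AntiIntegrable.closedBall (⇑ρ) (r + R) :=
    hmemA _ fun i => by simpa using hrR.le
  have hΔbound : ∀ u : AntiIntegrable.Config s d, (∀ i, u i ∈ Metric.closedBall (v i) r) →
      ∀ i, ‖Δ u i‖ ≤ K₀ * (r + R) + ‖h₀‖ := by
    intro u hu i
    have h1 := hK'.norm_sub_le (hmemA u (hnear u hu)) hρA (hnear u hu) i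
    rw [hΔ.apply_hom] at h1
    have h2 := norm_sub_norm_le (Δ u i) h₀
    linarith
  have heq : ∀ u : AntiIntegrable.Config s d,
      (Δ + lam • Ψ) u = 0 → ∀ i, Δ u i + lam • ψ (u i) = 0 := by
    intro u hu i
    have := congrFun hu i
    simpa [hΨ u i] using this
  obtain ⟨u, hu, hueq⟩ := AntiIntegrable.exists_solution_near_zeros hψ hK' hlam0 hKlam hvO
    (fun u hu => hmemA u (hnear u fun i => hu i (mem_univ i)))
    (fun u hu i => (hΔbound u (fun i => hu i (mem_univ i)) i).trans (by linarith))
  have hunique : ∀ u' : AntiIntegrable.Config s d, (Δ + lam • Ψ) u' = 0 →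
      AntiIntegrable.InCommonBalls O r u u' →
      AntiIntegrable.supDist u' (⇑ρ) ≤ ENNReal.ofReal (r + R) → u = u' :=
    fun u' hu' hcommon hd => AntiIntegrable.eq_of_inCommonBalls hψ hK' hlam0 hKlam
      (hmemA u (hnear u hu)) hd hueq (heq u' hu') hcommon
  refine ⟨u, ?_, ?_, hmemA u (hnear u hu), ?_, hunique⟩
  · ext1 i
    simpa [hΨ u i] using hueq i
  · refine iSup_le fun i => (Metric.infEDist_le_edist_of_mem (hvO i)).trans ?_
    rw [edist_dist]
    exact ENNReal.ofReal_le_ofReal (hu i)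
  · intro hlt u' hu' hcommon
    refine hunique u' hu' hcommon ((AntiIntegrable.supDist_le_ofReal hrR.le).2 (hnear u' ?_))
    have hthr' : K₀ * (r + R) + ‖h₀‖ < lam * (r * m) := (div_lt_iff₀ (mul_pos hr hm)).1 hlt
    intro i
    obtain ⟨x, hxO, hux, hux'⟩ := hcommon i
    -- Strictness of λ > λ_* places ψ(u i) in the open ball, so the common centre x equals v i and
    -- u' i also lies within r of v i, hence within r + R of ρ i.
    have hψu : ‖ψ (u i)‖ < m * r := by
      have h1 : lam * ‖ψ (u i)‖ = ‖Δ u i‖ := by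
        rw [eq_neg_of_add_eq_zero_left (hueq i), norm_neg, norm_smul,
          Real.norm_of_nonneg hlam0.le]
      have h2 := hΔbound u hu i
      refine lt_of_mul_lt_mul_left (a := lam) ?_ hlam0.le
      linarith
    rwa [eq_of_expanding_of_mem_closedBall hψ.continuous hm (hψ.zero _ (hvO i))
      (hψ.zero _ hxO) (hψ.expanding _ (hvO i)) (hψ.expanding _ hxO) (hu i) hux hψu]
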